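/- For a finite set $\mathcal S\subset\mathbb Z^2$ and $\theta\in[0,\pi/2]$ let $H_\theta=\{(x,y)\in\mathbb R^2 : x\sin\theta+y\cos\theta\ge 0\}$ and let $h_n(\theta)$ be the number of walks $x_0,x_1,\dots,x_n$ in $\mathbb Z^2$ with $x_0=(0,0)$, $x_{k+1}-x_k\in\mathcal S$ for $0\le k<n$, and $x_k\in H_\theta$ for $0\le k\le n$. Put $\rho(\theta)^{-1}=\lim_{n\to\infty}h_n(\theta)^{1/n}$. Say that $\mathcal S$ defines a non-trivial quarter-plane model if $\mathcal S$ is not contained in a line through the origin and, for every $\theta\in(0,\pi/2)$, the set $\mathcal A(\theta)=\{i\sin\theta+j\cos\theta : (i,j)\in\mathcal S\}$ contains both a positive and a negative element. **Lemma.** Let $\mathcal S\subset\mathbb Z^2$ be a finite set that defines a non-trivial quarter-plane model. Let $\theta^*\in[0,\pi/2]$ be an angle at which $\rho$ attains its maximum over $[0,\pi/2]$, and assume that $m=\tan(\theta^*)$ is irrational (in particular $\theta^*\neq\pi/2$). Then the language over the alphabet $\mathcal S$ consisting of all words $s_1s_2\cdots s_n$ ($n\ge 0$) with $s_1+\dots+s_k\in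 H_{\theta^*}$ for all $0\le k\le n$ is not context-free. -/

import Mathlib

open scoped ENNReal

namespace LatticeWalk

noncomputable section

/-- A lattice point, seen in the real plane. -/
def toPlane (z : ℤ × ℤ) : ℝ × ℝ := ((z.1 : ℝ), (z.2 : ℝ))

/-- The closed half-plane `x sin θ + y cos θ ≥ 0`. -/
def halfPlane (θ : ℝ) : Set (ℝ × ℝ) :=
  {p | 0 ≤ p.1 * Real.sin θ + p.2 * Real.cos θ}

/-- The walks `x₀, x₁, …, xₙ` of length `n` that start at the origin, take their steps in `S`
and stay in the region `C`. -/
def walks (C : Set (ℝ × ℝ)) (S : Finset (ℤ × ℤ)) (n : ℕ) : Set (Fin (n + 1) → ℤ × ℤ) :=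
  {x | x 0 = 0 ∧ (∀ j : Fin n, x j.succ - x j.castSucc ∈ S) ∧ ∀ i, toPlane (x i) ∈ C}

/-- `h_n(θ)`, the number of walks of length `n` in the half-plane `H_θ`. -/
def halfPlaneCount (S : Finset (ℤ × ℤ)) (θ : ℝ) (n : ℕ) : ℕ :=
  (walks (halfPlane θ) S n).ncard

/-- The exponential growth factor `lim h_n(θ)^(1/n)` of the half-plane model. The sequence `h_n(θ)`
is supermultiplicative and at most `|S|^n`, so this limit always exists. -/
def growthFactor (S : Finset (ℤ × ℤ)) (θ : ℝ) : ℝ≥0∞ :=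
  Filter.limUnder Filter.atTop (fun n : ℕ => (halfPlaneCount S θ n : ℝ≥0∞) ^ (1 / (n : ℝ)))

/-- `ρ(θ)`, the inverse of the exponential growth factor. -/
def rho (S : Finset (ℤ × ℤ)) (θ : ℝ) : ℝ≥0∞ := (growthFactor S θ)⁻¹

/-- `θ` maximizes `ρ` on `[0, π/2]`. -/
def IsOptimalAngle (S : Finset (ℤ × ℤ)) (θ : ℝ) : Prop :=
  θ ∈ Set.Icc 0 (Real.pi / 2) ∧ IsMaxOn (rho S) (Set.Icc 0 (Real.pi / 2)) θ

/-- The steps `i sin θ + j cos θ` of the associated unidimensional model. -/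
def projectedSteps (S : Finset (ℤ × ℤ)) (θ : ℝ) : Set ℝ :=
  {a | ∃ s ∈ S, a = (s.1 : ℝ) * Real.sin θ + (s.2 : ℝ) * Real.cos θ}

/-- A unidimensional model is non-trivial if it has both a positive and a negative step. -/
def IsNontrivialUnidimensional (A : Set ℝ) : Prop :=
  (∃ a ∈ A, 0 < a) ∧ ∃ b ∈ A, b < 0

/-- A step set defines a non-trivial quarter-plane model if it is truly two-dimensional (not
contained in a line through the origin) and its unidimensional models are non-trivial. Nothing is
required of the two extreme angles `0` and `π/2`. -/
structure IsNontrivialQuarterPlane (S : Finset (ℤ × ℤ)) : Prop where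
  not_collinear : ∃ s ∈ S, ∃ t ∈ S, s.1 * t.2 ≠ s.2 * t.1
  nontrivial_projection : ∀ θ ∈ Set.Ioo 0 (Real.pi / 2),
    IsNontrivialUnidimensional (projectedSteps S θ)

/-- The sequence of points visited by the walk that a word over the alphabet `S` encodes. -/
def wordPath {S : Finset (ℤ × ℤ)} (w : List S) : Fin (w.length + 1) → ℤ × ℤ :=
  fun k => ((w.take k).map Subtype.val).sum

/-- The language over the alphabet `S` of the words that encode walks staying in `H_θ`. -/
def halfPlaneLanguage (S : Finset (ℤ × ℤ)) (θ : ℝ) : Language S :=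
  {w : List S | wordPath w ∈ walks (halfPlane θ) S w.length}

end

end LatticeWalk

/-! Call x sin θ + y cos θ the height of a lattice point. When tan θ is irrational, only the origin
has height 0, so non-collinear steps have incommensurable heights; non-triviality supplies such
steps a, b with heights α > 0 > -β. The values pα - qβ ≥ 0 then get arbitrarily small without
vanishing, so for each pumping length N some word a^p b^q of the language, longer than N, ends lower
than any word of 1 to N letters a, b of nonnegative height. The pumped letters cannot have negative
total height, since pumping up would leave the half-plane; hence their height exceeds that of the
whole word, and deleting them ends below the boundary. See
`exists_nat_mul_sub_nat_mul_lt_of_irrational` and `Language.IsContextFree.pumping_lemma`. -/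

namespace ContextFreeGrammar

/-! ### The pumping lemma -/

variable {T : Type*} {g : ContextFreeGrammar T}

theorem Derives.append {s₁ s₂ t₁ t₂ : List (Symbol T g.NT)} (h₁ : g.Derives s₁ t₁)
    (h₂ : g.Derives s₂ t₂) : g.Derives (s₁ ++ s₂) (t₁ ++ t₂) :=
  (h₁.append_right s₂).trans (h₂.append_left t₁)

theorem derives_output {r : ContextFreeRule T g.NT} (hr : r ∈ g.rules) :
    g.Derives [.nonterminal r.input] r.output :=
  Produces.single ⟨r, hr, ContextFreeRule.Rewrites.input_output⟩

/-- `g.SimpleParse V s w` says that the string `s` has a parse forest with yield `w` in which no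
nonterminal occurs twice on a path from a root, and no nonterminal of `V` occurs at all. -/
inductive SimpleParse (g : ContextFreeGrammar T) [DecidableEq g.NT] :
    Finset g.NT → List (Symbol T g.NT) → List T → Prop
  | nil (V : Finset g.NT) : SimpleParse g V [] []
  | terminal {V : Finset g.NT} {s : List (Symbol T g.NT)} {w : List T} (t : T)
      (h : SimpleParse g V s w) : SimpleParse g V (.terminal t :: s) (t :: w)
  | nonterminal {V : Finset g.NT} {s : List (Symbol T g.NT)} {v w : List T}
      (r : ContextFreeRule T g.NT) (hr : r ∈ g.rules) (hV : r.input ∉ V)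
      (h₁ : SimpleParse g (insert r.input V) r.output v) (h₂ : SimpleParse g V s w) :
      SimpleParse g V (.nonterminal r.input :: s) (v ++ w)

namespace SimpleParse

variable [DecidableEq g.NT]

theorem mono {V W : Finset g.NT} {s : List (Symbol T g.NT)} {w : List T}
    (h : g.SimpleParse V s w) (hWV : W ⊆ V) : g.SimpleParse W s w := by
  induction h generalizing W with
  | nil V => exact .nil _
  | terminal t _ ih => exact .terminal t (ih hWV)
  | nonterminal r hr hV _ _ ih₁ ih₂ =>
    exact .nonterminal r hr (fun h => hV (hWV h)) (ih₁ (Finset.insert_subset_insert _ hWV))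
      (ih₂ hWV)

theorem derives {V : Finset g.NT} {s : List (Symbol T g.NT)} {w : List T}
    (h : g.SimpleParse V s w) : g.Derives s (w.map .terminal) := by
  induction h with
  | nil V => exact Derives.refl _
  | terminal t _ ih => exact ih.append_left [.terminal t]
  | nonterminal r hr hV _ _ ih₁ ih₂ =>
    rw [List.map_append]
    exact ((derives_output hr).trans ih₁).append ih₂

theorem of_terminals (V : Finset g.NT) (w : List T) : g.SimpleParse V (w.map .terminal) w := by
  induction w with
  | nil => exact .nil V
  | cons t w ih => exact .terminal t ih

theorem append {V : Finset g.NT} {s₁ s₂ : List (Symbol T g.NT)} {w₁ w₂ : List T}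
    (h₁ : g.SimpleParse V s₁ w₁) (h₂ : g.SimpleParse V s₂ w₂) :
    g.SimpleParse V (s₁ ++ s₂) (w₁ ++ w₂) := by
  induction h₁ with
  | nil V => exact h₂
  | terminal t _ ih => exact .terminal t (ih h₂)
  | nonterminal r hr hV h _ _ ih =>
    rw [List.append_assoc]
    exact .nonterminal r hr hV h (ih h₂)

theorem exists_of_append {V : Finset g.NT} (s₁ : List (Symbol T g.NT))
    {s₂ : List (Symbol T g.NT)} {w : List T} (h : g.SimpleParse V (s₁ ++ s₂) w) :
    ∃ w₁ w₂, w = w₁ ++ w₂ ∧ g.SimpleParse V s₁ w₁ ∧ g.SimpleParse V s₂ w₂ := by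
  induction s₁ generalizing w with
  | nil => exact ⟨[], w, rfl, .nil V, h⟩
  | cons x s₁ ih =>
    cases h with
    | terminal t h =>
      obtain ⟨w₁, w₂, rfl, h₁, h₂⟩ := ih h
      exact ⟨t :: w₁, w₂, rfl, .terminal t h₁, h₂⟩
    | nonterminal r hr hV h h' =>
      obtain ⟨w₁, w₂, rfl, h₁, h₂⟩ := ih h'
      exact ⟨_, w₂, (List.append_assoc _ _ _).symm, .nonterminal r hr hV h h₁, h₂⟩

/-- Either a nonterminal does not occur in a parse forest, or the forest can be cut at it. -/
theorem insert_or_exists_cut {V : Finset g.NT} {s : List (Symbol T g.NT)} {w : List T}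
    (h : g.SimpleParse V s w) (A : g.NT) :
    g.SimpleParse (insert A V) s w ∨ ∃ v x y, w = v ++ x ++ y ∧
      g.Derives s (v.map .terminal ++ [.nonterminal A] ++ y.map .terminal) ∧
      g.SimpleParse ∅ [.nonterminal A] x := by
  induction h with
  | nil V => exact .inl (.nil _)
  | @terminal V s w t _ ih =>
    obtain ih | ⟨v, x, y, rfl, h₁, h₂⟩ := ih
    · exact .inl (.terminal t ih)
    · exact .inr ⟨t :: v, x, y, rfl, h₁.append_left [.terminal t], h₂⟩
  | @nonterminal V s v w r hr hV h₁ h₂ ih₁ ih₂ =>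
    by_cases hA : r.input = A
    · refine .inr ⟨[], v, w, rfl, ?_, ?_⟩
      · rw [← hA]
        exact h₂.derives.append_left [.nonterminal r.input]
      · rw [← hA, ← List.append_nil v]
        exact .nonterminal r hr (Finset.notMem_empty _)
          (h₁.mono (Finset.insert_subset_insert _ (Finset.empty_subset V))) (.nil _)
    obtain ih₁ | ⟨v', x, y, rfl, h₁', hx⟩ := ih₁
    · obtain ih₂ | ⟨v', x, y, rfl, h₂', hx⟩ := ih₂
      · refine .inl (.nonterminal r hr ?_ ?_ ih₂)
        · simp [hA, hV]
        · rwa [Finset.insert_comm]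
      · refine .inr ⟨v ++ v', x, y, by simp, ?_, hx⟩
        simpa using ((derives_output hr).trans h₁.derives).append h₂'
    · refine .inr ⟨v', x, y ++ w, by simp, ?_, hx⟩
      simpa using ((derives_output hr).trans h₁').append h₂.derives

/-- Along a path nonterminals are distinct rule inputs outside `V`, which bounds the depth, while
`b` bounds the branching. -/
theorem length_le {b : ℕ} (hb : 1 ≤ b) (hg : ∀ r ∈ g.rules, r.output.length ≤ b)
    {V : Finset g.NT} {s : List (Symbol T g.NT)} {w : List T} (h : g.SimpleParse V s w) :
    w.length ≤ s.length * b ^ (g.rules.image ContextFreeRule.input \ V).card := by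
  induction h with
  | nil V => simp
  | @terminal V s w t _ ih =>
    have := Nat.one_le_pow (g.rules.image ContextFreeRule.input \ V).card b hb
    simp only [List.length_cons, Nat.add_mul]
    omega
  | @nonterminal V s v w r hr hV _ _ ih₁ ih₂ =>
    have hmem : r.input ∈ g.rules.image ContextFreeRule.input \ V :=
      Finset.mem_sdiff.2 ⟨Finset.mem_image_of_mem _ hr, hV⟩
    rw [Finset.sdiff_insert, Finset.card_erase_of_mem hmem] at ih₁
    have hpos := Finset.card_pos.2 ⟨_, hmem⟩
    have : v.length ≤ b ^ (g.rules.image ContextFreeRule.input \ V).card := by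
      calc v.length ≤ _ := ih₁
        _ ≤ b * b ^ ((g.rules.image ContextFreeRule.input \ V).card - 1) :=
          Nat.mul_le_mul_right _ (hg r hr)
        _ = _ := mul_pow_sub_one hpos.ne' b
    simp only [List.length_cons, List.length_append, Nat.add_mul]
    omega

end SimpleParse

/-- A string that derives a word either has a repetition-free parse, or its derivation contains a
short loop with nonempty yield. -/
theorem Derives.simpleParse_or_exists_loop [DecidableEq g.NT] {N : ℕ}
    (hN : ∀ r ∈ g.rules, ∀ w, g.SimpleParse ∅ r.output w → w.length ≤ N)
    {s : List (Symbol T g.NT)} {w : List T} (h : g.Derives s (w.map .terminal)) :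
    g.SimpleParse ∅ s w ∨ ∃ (A : g.NT) (u v x y z : List T), w = u ++ v ++ x ++ y ++ z ∧
      (v ++ x ++ y).length ≤ N ∧ v ++ y ≠ [] ∧
      g.Derives s (u.map .terminal ++ [.nonterminal A] ++ z.map .terminal) ∧
      g.Derives [.nonterminal A] (v.map .terminal ++ [.nonterminal A] ++ y.map .terminal) ∧
      g.Derives [.nonterminal A] (x.map .terminal) := by
  induction h using Relation.ReflTransGen.head_induction_on with
  | refl => exact .inl (.of_terminals ∅ w)
  | @head s s' hs hs' ih =>
    obtain ih | ⟨A, u, v, x, y, z, hw, hlen, hne, h₁, h₂, h₃⟩ := ih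
    swap
    · exact .inr ⟨A, u, v, x, y, z, hw, hlen, hne, hs.trans_derives h₁, h₂, h₃⟩
    obtain ⟨r, hr, hrs⟩ := hs
    obtain ⟨p, q, rfl, rfl⟩ := hrs.exists_parts
    obtain ⟨w', w₃, rfl, h', h₃⟩ := ih.exists_of_append
    obtain ⟨w₁, w₂, rfl, h₁, h₂⟩ := h'.exists_of_append
    obtain h | ⟨v, x, y, rfl, hd, hx⟩ := h₂.insert_or_exists_cut r.input
    · refine .inl ((h₁.append ?_).append h₃)
      rw [← List.append_nil w₂]
      exact .nonterminal r hr (Finset.notMem_empty _) h (.nil _)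
    -- An empty loop can be cut out, leaving the parse of `x`. Otherwise `v ++ x ++ y` is the yield
    -- of a simple parse of `r.output`, hence short.
    by_cases hvy : v ++ y = []
    · obtain ⟨rfl, rfl⟩ := List.append_eq_nil_iff.1 hvy
      refine .inl ((h₁.append ?_).append h₃)
      simpa using hx
    · refine .inr ⟨r.input, w₁, v, x, y, w₃, by simp, hN r hr _ h₂, hvy, ?_,
        (derives_output hr).trans hd, hx.derives⟩
      exact (h₁.derives.append_right _).append h₃.derives

theorem derives_iterate {A : g.NT} {v y : List T}
    (h : g.Derives [.nonterminal A] (v.map .terminal ++ [.nonterminal A] ++ y.map .terminal))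
    (i : ℕ) : g.Derives [.nonterminal A] ((List.replicate i v).flatten.map .terminal ++
      [.nonterminal A] ++ (List.replicate i y).flatten.map .terminal) := by
  induction i with
  | zero => simpa using Derives.refl _
  | succ i ih =>
    refine h.trans ?_
    have := (ih.append_left (v.map .terminal)).append_right (y.map .terminal)
    rw [List.replicate_succ, List.replicate_succ', List.flatten_cons, List.flatten_append]
    simpa only [List.map_append, List.append_assoc, List.flatten_singleton] using this

end ContextFreeGrammar

/-- The pumping lemma for context-free languages. -/
theorem Language.IsContextFree.pumping_lemma {T : Type*} {L : Language T}
    (hL : L.IsContextFree) : ∃ N : ℕ, ∀ w ∈ L, N < w.length →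
      ∃ u v x y z : List T, w = u ++ v ++ x ++ y ++ z ∧ (v ++ x ++ y).length ≤ N ∧ v ++ y ≠ [] ∧
        ∀ i : ℕ, u ++ (List.replicate i v).flatten ++ x ++ (List.replicate i y).flatten ++ z ∈ L := by
  classical
  obtain ⟨g, rfl⟩ := hL
  -- The `+ 1` keeps the base positive even when no rule has a nonempty output.
  set b := g.rules.sup (fun r => r.output.length) + 1 with hb
  have hg : ∀ r ∈ g.rules, r.output.length ≤ b := fun r hr =>
    (Finset.le_sup (f := fun r => r.output.length) hr).trans (Nat.le_succ _)
  set n := (g.rules.image ContextFreeRule.input \ ∅).card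
  have hb1 : 1 ≤ b := Nat.le_add_left _ _
  refine ⟨b * b ^ n, fun w hw hlen => ?_⟩
  have hN : ∀ r ∈ g.rules, ∀ w, g.SimpleParse ∅ r.output w → w.length ≤ b * b ^ n :=
    fun r hr w h => (h.length_le hb1 hg).trans (Nat.mul_le_mul_right _ (hg r hr))
  rw [ContextFreeGrammar.mem_language_iff] at hw
  obtain h | ⟨A, u, v, x, y, z, rfl, hlen', hne, h₁, h₂, h₃⟩ := hw.simpleParse_or_exists_loop hN
  · have h1 : w.length ≤ 1 * b ^ n := h.length_le hb1 hg
    exact absurd hlen (not_lt.2 (h1.trans (Nat.mul_le_mul_right _ hb1)))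
  · refine ⟨u, v, x, y, z, rfl, hlen', hne, fun i => ?_⟩
    rw [ContextFreeGrammar.mem_language_iff]
    refine h₁.trans ?_
    have := ((((ContextFreeGrammar.derives_iterate h₂ i).trans
      ((h₃.append_left _).append_right _)).append_left (u.map .terminal)).append_right
        (z.map .terminal))
    simpa only [List.map_append, List.append_assoc] using this

/-! ### Diophantine approximation -/

/-- Values of `p * α - q * β` with `p, q ≥ 0` come arbitrarily close to `0` from above. -/
theorem exists_nat_mul_sub_nat_mul_lt {α β ε : ℝ} (hα : 0 < α) (hβ : 0 < β) (hε : 0 < ε) :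
    ∃ p q : ℕ, 0 < p ∧ 0 ≤ p * α - q * β ∧ p * α - q * β < ε := by
  -- Dirichlet's error, scaled by β, falls below both ε and α; the bound α forces `j ≥ 0`, as `k ≥
  -- 1`.
  obtain ⟨n, hn⟩ := exists_nat_gt (max (β / ε) (β / α))
  have hnε : β / ε < n := (le_max_left _ _).trans_lt hn
  have hnα : β / α < n := (le_max_right _ _).trans_lt hn
  have hn0 : (0 : ℝ) < n := (div_pos hβ hε).trans hnε
  obtain ⟨j, k, hk, -, hjk⟩ :=
    Real.exists_int_int_abs_mul_sub_le (α / β) (Nat.cast_pos.1 hn0)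
  have key : |(k : ℝ) * α - j * β| < min ε α := by
    have h1 : (k : ℝ) * α - j * β = β * (k * (α / β) - j) := by field_simp
    rw [h1, abs_mul, abs_of_pos hβ]
    have h2 : β * |(k : ℝ) * (α / β) - j| ≤ β * (1 / (n + 1)) :=
      mul_le_mul_of_nonneg_left hjk hβ.le
    refine h2.trans_lt ?_
    rw [mul_one_div, div_lt_iff₀ (by positivity)]
    rw [div_lt_iff₀ hε] at hnε
    rw [div_lt_iff₀ hα] at hnα
    rcases min_choice ε α with h | h <;> rw [h] <;> nlinarith
  obtain ⟨hlε, hlα⟩ := lt_min_iff.1 key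
  have hk1 : (1 : ℝ) ≤ k := by exact_mod_cast hk
  have hj : 0 ≤ j := by
    by_contra! hj
    have hj1 : (j : ℝ) ≤ -1 := by exact_mod_cast Int.le_sub_one_of_lt hj
    have := (abs_lt.1 hlα).2
    nlinarith
  lift k to ℕ using hk.le
  lift j to ℕ using hj
  simp only [Int.cast_natCast] at *
  rcases le_or_gt 0 ((k : ℝ) * α - j * β) with h | h
  · exact ⟨k, j, by exact_mod_cast hk, h, (le_abs_self _).trans_lt hlε⟩
  -- An error -δ of the wrong sign is added ⌊α/δ⌋ times to α, leaving a remainder in [0, δ).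
  · set δ := -((k : ℝ) * α - j * β) with hδ
    have hδ0 : 0 < δ := by linarith
    have hr := Nat.floor_le (div_pos hα hδ0).le
    have hr' := Nat.lt_floor_add_one (α / δ)
    rw [le_div_iff₀ hδ0] at hr
    rw [div_lt_iff₀ hδ0] at hr'
    have hδε : δ < ε := (neg_le_abs _).trans_lt hlε
    refine ⟨1 + ⌊α / δ⌋₊ * k, ⌊α / δ⌋₊ * j, by omega, ?_, ?_⟩ <;> push_cast <;> nlinarith

/-- By irrationality the finitely many competing values are positive, so some ε > 0 bounds them
below; a value below ε needs more than `N` letters. -/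
theorem exists_nat_mul_sub_nat_mul_lt_of_irrational {α β : ℝ} (hα : 0 < α) (hβ : 0 < β)
    (h : Irrational (α / β)) (N : ℕ) :
    ∃ p q : ℕ, N < p + q ∧ 0 ≤ p * α - q * β ∧ ∀ s t : ℕ, s + t ≠ 0 → s + t ≤ N →
      0 ≤ s * α - t * β → p * α - q * β < s * α - t * β := by
  have hpos : ∀ s t : ℕ, s + t ≠ 0 → 0 ≤ s * α - t * β → 0 < s * α - t * β := by
    intro s t hst h0
    refine lt_of_le_of_ne h0 fun he => ?_
    rcases Nat.eq_zero_or_pos s with rfl | hs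
    · have ht : (0 : ℝ) < t := by exact_mod_cast (by omega : 0 < t)
      have := mul_pos ht hβ
      simp at he
      rcases he with rfl | rfl
      · simp at ht
      · exact lt_irrefl _ hβ
    · have hs' : (0 : ℝ) < s := by exact_mod_cast hs
      refine h ⟨(t : ℚ) / s, ?_⟩
      push_cast
      rw [div_eq_div_iff hs'.ne' hβ.ne']
      linarith
  let F : Finset (ℕ × ℕ) := (Finset.range (N + 1) ×ˢ Finset.range (N + 1)).filter
    fun x => x.1 + x.2 ≠ 0 ∧ (0 : ℝ) ≤ x.1 * α - x.2 * β
  obtain ⟨ε, hε, hF⟩ : ∃ ε : ℝ, 0 < ε ∧ ∀ x ∈ F, ε ≤ x.1 * α - x.2 * β := by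
    rcases F.eq_empty_or_nonempty with hF | hF
    · exact ⟨1, one_pos, by simp [hF]⟩
    · obtain ⟨x, hx, hmin⟩ := F.exists_min_image (fun x => (x.1 : ℝ) * α - x.2 * β) hF
      have hx' := (Finset.mem_filter.1 hx).2
      exact ⟨_, hpos _ _ hx'.1 hx'.2, hmin⟩
  have hF' : ∀ s t : ℕ, s + t ≠ 0 → s + t ≤ N → (0 : ℝ) ≤ s * α - t * β →
      ε ≤ s * α - t * β := fun s t h1 h2 h3 => hF (s, t) <| by
    simp only [F, Finset.mem_filter, Finset.mem_product, Finset.mem_range]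
    exact ⟨⟨by omega, by omega⟩, h1, h3⟩
  obtain ⟨p, q, hp, h0, hlt⟩ := exists_nat_mul_sub_nat_mul_lt hα hβ hε
  refine ⟨p, q, ?_, h0, fun s t h1 h2 h3 => hlt.trans_le (hF' s t h1 h2 h3)⟩
  by_contra! hpq
  exact absurd hlt (not_lt.2 (hF' p q (by omega) hpq h0))

/-! ### Heights of lattice walks -/

namespace LatticeWalk

/-- The projection `(i, j) ↦ i sin θ + j cos θ` of the lattice to the line. -/
noncomputable def projection (θ : ℝ) : ℤ × ℤ →+ ℝ where
  toFun z := z.1 * Real.sin θ + z.2 * Real.cos θ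
  map_zero' := by simp
  map_add' x y := by simp; ring

theorem projection_apply (θ : ℝ) (z : ℤ × ℤ) :
    projection θ z = z.1 * Real.sin θ + z.2 * Real.cos θ := rfl

theorem eq_zero_of_projection_eq_zero {θ : ℝ} (hm : Irrational (Real.tan θ)) {z : ℤ × ℤ}
    (h : projection θ z = 0) : z = 0 := by
  -- Where the cosine vanishes, `Real.tan` takes the default value 0, which is rational.
  have hcos : Real.cos θ ≠ 0 := fun h0 => hm.ne_zero (by simp [Real.tan_eq_sin_div_cos, h0])
  have h1 : (z.1 : ℝ) * Real.tan θ + z.2 = 0 := by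
    rw [Real.tan_eq_sin_div_cos]
    field_simp
    rw [projection_apply] at h
    linarith
  have hz1 : z.1 = 0 := by
    by_contra hz
    refine ((hm.intCast_mul hz).add_intCast z.2).ne_zero h1
  rw [hz1] at h1
  exact Prod.ext hz1 (by simpa using h1)

/-- A rational ratio gives an integer relation between the heights, hence between the vectors. -/
theorem irrational_projection_div {θ : ℝ} (hm : Irrational (Real.tan θ)) {a b : ℤ × ℤ}
    (hab : a.1 * b.2 ≠ a.2 * b.1) : Irrational (projection θ a / projection θ b) := by
  rintro ⟨c, hc⟩
  have hb : projection θ b ≠ 0 := fun h => hab (by simp [eq_zero_of_projection_eq_zero hm h])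
  have hd : (c.den : ℝ) ≠ 0 := by exact_mod_cast c.den_ne_zero
  have h1 : projection θ ((c.den : ℤ) • a - c.num • b) = 0 := by
    rw [Rat.cast_def, div_eq_div_iff hd hb] at hc
    rw [map_sub, map_zsmul, map_zsmul, zsmul_eq_mul, zsmul_eq_mul, Int.cast_natCast]
    linarith
  have h2 := eq_zero_of_projection_eq_zero hm h1
  have h3 : (c.den : ℤ) * a.1 = c.num * b.1 := by
    simpa [sub_eq_zero] using congrArg Prod.fst h2
  have h4 : (c.den : ℤ) * a.2 = c.num * b.2 := by
    simpa [sub_eq_zero] using congrArg Prod.snd h2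
  have hd' : (c.den : ℤ) ≠ 0 := by exact_mod_cast c.den_ne_zero
  apply hab
  apply mul_left_cancel₀ hd'
  linear_combination b.2 * h3 - b.1 * h4

theorem mul_eq_mul_of_collinear {u v w : ℤ × ℤ} (hw : w ≠ 0) (hu : u.1 * w.2 = u.2 * w.1)
    (hv : v.1 * w.2 = v.2 * w.1) : u.1 * v.2 = u.2 * v.1 := by
  by_cases h1 : w.1 = 0
  · have h2 : w.2 ≠ 0 := fun h2 => hw (Prod.ext h1 h2)
    apply mul_left_cancel₀ h2
    linear_combination v.2 * hu - u.2 * hv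
  · apply mul_left_cancel₀ h1
    linear_combination v.1 * hu - u.1 * hv

/-- A non-trivial model has a positive and a negative step that are not collinear. -/
theorem IsNontrivialQuarterPlane.exists_pos_neg_not_collinear {S : Finset (ℤ × ℤ)}
    (hS : IsNontrivialQuarterPlane S) {θ : ℝ} (hθ : θ ∈ Set.Ioo 0 (Real.pi / 2))
    (hm : Irrational (Real.tan θ)) : ∃ a ∈ S, ∃ b ∈ S,
      0 < projection θ a ∧ projection θ b < 0 ∧ a.1 * b.2 ≠ a.2 * b.1 := by
  obtain ⟨⟨_, ⟨p, hp, rfl⟩, hp0⟩, _, ⟨q, hq, rfl⟩, hq0⟩ := hS.nontrivial_projection θ hθ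
  rw [← projection_apply] at hp0 hq0
  by_contra! h
  have hpne : p ≠ 0 := by rintro rfl; simp at hp0
  have hqne : q ≠ 0 := by rintro rfl; simp at hq0
  -- If every positive step is parallel to every negative one, all steps lie on the line of `p`:
  -- positive ones by way of `q`, and those of height 0 are zero.
  have hall : ∀ s ∈ S, s.1 * p.2 = s.2 * p.1 := by
    intro s hs
    rcases lt_trichotomy (projection θ s) 0 with h0 | h0 | h0
    · linarith [h p hp s hs hp0 h0]
    · simp [eq_zero_of_projection_eq_zero hm h0]
    · exact mul_eq_mul_of_collinear hqne (h s hs q hq h0 hq0) (h p hp q hq hp0 hq0)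
  obtain ⟨s, hs, t, ht, hst⟩ := hS.not_collinear
  exact hst (mul_eq_mul_of_collinear hpne (hall s hs) (hall t ht))

/-- The projection of the end point of the walk that a word encodes. -/
noncomputable def wordHeight {S : Finset (ℤ × ℤ)} (θ : ℝ) (w : List S) : ℝ :=
  (w.map fun s : S => projection θ s).sum

section wordHeight

variable {S : Finset (ℤ × ℤ)} {θ : ℝ}

theorem projection_sum (w : List S) :
    projection θ (w.map Subtype.val).sum = wordHeight θ w := by
  rw [wordHeight, map_list_sum, List.map_map]
  rfl

theorem wordHeight_append (v w : List S) :
    wordHeight θ (v ++ w) = wordHeight θ v + wordHeight θ w := by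
  simp [wordHeight]

theorem wordHeight_replicate (n : ℕ) (s : S) :
    wordHeight θ (List.replicate n s) = n * projection θ s := by
  simp [wordHeight]

theorem wordHeight_flatten_replicate (n : ℕ) (w : List S) :
    wordHeight θ (List.replicate n w).flatten = n * wordHeight θ w := by
  induction n with
  | zero => simp [wordHeight]
  | succ n ih =>
    rw [List.replicate_succ, List.flatten_cons, wordHeight_append, ih]
    push_cast
    ring

theorem exists_wordHeight_eq_of_forall_mem {a b : S} (w : List S)
    (h : ∀ s ∈ w, s = a ∨ s = b) : ∃ m n : ℕ, m + n = w.length ∧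
      wordHeight θ w = m * projection θ a + n * projection θ b := by
  induction w with
  | nil => exact ⟨0, 0, rfl, by simp [wordHeight]⟩
  | cons s w ih =>
    obtain ⟨m, n, hmn, hw⟩ := ih fun x hx => h x (List.mem_cons_of_mem _ hx)
    have hs : wordHeight θ (s :: w) = projection θ s + wordHeight θ w := by simp [wordHeight]
    rcases h s List.mem_cons_self with rfl | rfl
    · exact ⟨m + 1, n, by simp; omega, by rw [hs, hw]; push_cast; ring⟩
    · exact ⟨m, n + 1, by simp; omega, by rw [hs, hw]; push_cast; ring⟩

theorem mem_halfPlaneLanguage_iff {w : List S} :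
    w ∈ halfPlaneLanguage S θ ↔ ∀ k ≤ w.length, 0 ≤ wordHeight θ (w.take k) := by
  have hC : ∀ i : Fin (w.length + 1), toPlane (wordPath w i) ∈ halfPlane θ ↔
      0 ≤ wordHeight θ (w.take i) := fun i => by
    rw [← projection_sum]
    rfl
  constructor
  · intro h k hk
    exact (hC ⟨k, Nat.lt_succ_of_le hk⟩).1 (h.2.2 _)
  · intro h
    refine ⟨by simp [wordPath], fun j => ?_, fun i => (hC i).2 (h i (Nat.le_of_lt_succ i.2))⟩
    have : wordPath w j.succ - wordPath w j.castSucc = w[(j : ℕ)] := by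
      simp only [wordPath, Fin.val_succ, Fin.val_castSucc]
      rw [← List.take_concat_get' w j j.2]
      simp
    rw [this]
    exact Subtype.property _

theorem wordHeight_nonneg_of_mem {w : List S} (h : w ∈ halfPlaneLanguage S θ) :
    0 ≤ wordHeight θ w := by
  simpa using mem_halfPlaneLanguage_iff.1 h w.length le_rfl

/-- The walk climbs, then descends, so its height is least at one of its two ends. -/
theorem replicate_append_replicate_mem {a b : S} (ha : 0 ≤ projection θ a)
    (hb : projection θ b ≤ 0) {p q : ℕ} (h : 0 ≤ p * projection θ a + q * projection θ b) :
    List.replicate p a ++ List.replicate q b ∈ halfPlaneLanguage S θ := by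
  refine mem_halfPlaneLanguage_iff.2 fun k _ => ?_
  rw [List.take_append, List.take_replicate, List.take_replicate, wordHeight_append,
    wordHeight_replicate, wordHeight_replicate, List.length_replicate]
  rcases le_total k p with hk | hk
  · rw [Nat.sub_eq_zero_of_le hk]
    simp only [Nat.zero_min, Nat.cast_zero, zero_mul, add_zero]
    positivity
  · rw [min_eq_right hk]
    have : ((min (k - p) q : ℕ) : ℝ) ≤ q := by exact_mod_cast min_le_right _ _
    nlinarith [mul_le_mul_of_nonpos_right this hb]

/-- Two letters with incommensurable heights of opposite signs prevent context-freeness. -/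
theorem not_isContextFree_halfPlaneLanguage {a b : S} (ha : 0 < projection θ a)
    (hb : projection θ b < 0) (hab : Irrational (projection θ a / projection θ b)) :
    ¬ (halfPlaneLanguage S θ).IsContextFree := by
  intro hL
  obtain ⟨N, hN⟩ := hL.pumping_lemma
  have hirr : Irrational (projection θ a / -projection θ b) := by
    rw [div_neg]
    exact hab.neg
  obtain ⟨p, q, hpq, h0, hmin⟩ :=
    exists_nat_mul_sub_nat_mul_lt_of_irrational ha (neg_pos.2 hb) hirr N
  simp only [mul_neg, sub_neg_eq_add] at h0 hmin
  obtain ⟨u, v, x, y, z, hw, hlen, hne, hpump⟩ :=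
    hN _ (replicate_append_replicate_mem ha.le hb.le h0) (by simpa using hpq)
  have hheight := congrArg (wordHeight θ) hw
  simp only [wordHeight_append, wordHeight_replicate] at hheight
  have hi : ∀ i : ℕ, 0 ≤ wordHeight θ u + wordHeight θ x + wordHeight θ z +
      i * wordHeight θ (v ++ y) := fun i => by
    have := wordHeight_nonneg_of_mem (hpump i)
    simp only [wordHeight_append, wordHeight_flatten_replicate] at this ⊢
    linarith
  have hletters : ∀ s ∈ v ++ y, s = a ∨ s = b := by
    intro s hs
    have : s ∈ List.replicate p a ++ List.replicate q b := by
      rw [hw]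
      simp only [List.mem_append] at hs ⊢
      tauto
    rcases List.mem_append.1 this with h | h
    · exact .inl (List.eq_of_mem_replicate h)
    · exact .inr (List.eq_of_mem_replicate h)
  obtain ⟨m, n, hmn, hvy⟩ := exists_wordHeight_eq_of_forall_mem (θ := θ) _ hletters
  -- The height is affine in the number of pumps, so a negative slope would eventually make it
  -- negative.
  have hvy0 : 0 ≤ wordHeight θ (v ++ y) := by
    by_contra! hneg
    obtain ⟨i, hi'⟩ := exists_nat_gt
      ((wordHeight θ u + wordHeight θ x + wordHeight θ z) / -wordHeight θ (v ++ y))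
    rw [div_lt_iff₀ (neg_pos.2 hneg)] at hi'
    linarith [hi i]
  -- Between 1 and `N` letters are pumped, so their height exceeds that of the whole word,
  -- contradicting `i = 0`.
  have hlt := hmin m n (by rw [hmn]; simpa using hne)
    (by rw [hmn]; simp only [List.length_append] at hlen ⊢; omega) (hvy ▸ hvy0)
  have h00 := hi 0
  rw [← hvy, wordHeight_append] at hlt
  simp only [Nat.cast_zero, zero_mul, add_zero] at h00
  linarith

end wordHeight

end LatticeWalk

theorem mainTheorem3 (S : Finset (ℤ × ℤ)) (hS : LatticeWalk.IsNontrivialQuarterPlane S)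
    (θ : ℝ) (hθ : LatticeWalk.IsOptimalAngle S θ) (hm : Irrational (Real.tan θ)) :
    ¬ (LatticeWalk.halfPlaneLanguage S θ).IsContextFree := by
  have hθ' : θ ∈ Set.Ioo 0 (Real.pi / 2) := by
    refine ⟨lt_of_le_of_ne hθ.1.1 ?_, lt_of_le_of_ne hθ.1.2 ?_⟩
    · rintro rfl
      exact hm.ne_zero Real.tan_zero
    · rintro rfl
      exact hm.ne_zero Real.tan_pi_div_two
  obtain ⟨a, haS, b, hbS, ha, hb, hab⟩ := hS.exists_pos_neg_not_collinear hθ' hm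
  exact LatticeWalk.not_isContextFree_halfPlaneLanguage (a := ⟨a, haS⟩) (b := ⟨b, hbS⟩) ha hb
    (LatticeWalk.irrational_projection_div hm hab)
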